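/- **Activation processes.** All graphs are finite and simple. An activation process is a tuple $\mathbf{A}=(H;\Delta_1,\ldots,\Delta_s)$, where $H$ is a graph and $\Delta_1,\ldots,\Delta_s$ are triangles such that, for every $i$, exactly one edge $e_i$ of $\Delta_i$ does not belong to $H\cup\Delta_1\cup\cdots\cup\Delta_{i-1}$; we say that $\Delta_i$ activates $e_i$. Let $K^{(1)}(\mathbf{A})=H\cup\Delta_1\cup\cdots\cup\Delta_s$. We say that $H$ activates a graph $G'$ via $\mathbf{A}$ if $G'\subseteq K^{(1)}(\mathbf{A})$. For an edge $e$ of $K^{(1)}(\mathbf{A})$ let $\mathrm{con}(e)$ be the number of triangles $\Delta_i$ that contain $e$ and do not activate it. Let $\mathrm{exc}(e)=\mathrm{con}(e)$ if $e\in E(G')\setminus E(H)$, $\mathrm{exc}(e)=\mathrm{con}(e)-2$ if $e\in E(H)\setminus E(G')$, and $\mathrm{exc}(e)=\mathrm{con}(e)-1$ otherwise. Let $\mathrm{exc}(\mathbf{A})=\sum_{e\in E(K^{(1)}(\mathbf{A}))}\mathrm{exc}(e)$. The process is nice if $\mathrm{exc}(e)\ge 0$ for every edge $e$ of $K^{(1)}(\mathbf{A})$.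 Let $d_H=|E(H)|-|V(H)|+1$. **Activation diagrams.** Let $H$ be connected and activate a cycle $C$ via a nice process $\mathbf{A}$. The $\mathbf{A}$-activation diagram of $C$ is the following simplicial complex $D_1$ with labelled vertices (different vertices may have equal labels). Start with $D_{s+1}=C$, each vertex labelled by itself and every edge marked. For $k=s,\ldots,1$, write $\Delta_k=\{x_1,x_2,y\}$ with $e_k=\{x_1,x_2\}$, and obtain $D_k$ from $D_{k+1}$ by gluing a triangle, whose third vertex is new and labelled $y$, to the unique marked edge of $D_{k+1}$ whose ends are labelled $x_1,x_2$; this edge becomes unmarked, and for $i=1,2$ the new edge with labels $x_i,y$ becomes marked if $D_{k+1}$ has no marked edge with labels $x_i,y$. The marks are then forgotten, and diagrams are identified when there is a label-preserving isomorphism of complexes between them. **Lemma.** Let $\ell,v,w,n$ be non-negative integers with $v\ge\ell\ge 3$, and let $P_{v,w}=P_{v,w}(\ell,n)$ be the collection of the $\mathbf{A}$-activation diagrams of all nice activation processes $\mathbf{A}=(H;\Delta_1,\ldots,\Delta_s)$ of $\ell$-cycles such that $H$ is connected, $V(H)\subseteq[n]$, $|V(H)|=v$ and $2d_H+\mathrm{exc}(\mathbf{A})=w$.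 Then $P_{v,w}$ is finite and $$|P_{v,w}|\le n^v\,(2v)^{4w}\,w^w\binom{2v+w-2}{w}\,2^{7v},$$ where $0^0=1$. -/

import Mathlib

noncomputable section

/-! ### Activation processes of triangle bootstrap percolation -/

/-- The complete graph on the vertex set `Δ`; a triangle when `Δ` has three elements. -/
def triangleGraph {α : Type*} (Δ : Finset α) : (⊤ : SimpleGraph α).Subgraph :=
  (⊤ : (⊤ : SimpleGraph α).Subgraph).induce (Δ : Set α)

/-- The graph `H ∪ Δ 0 ∪ ⋯ ∪ Δ (i - 1)`. -/
def stageGraph {α : Type*} {s : ℕ} (H : (⊤ : SimpleGraph α).Subgraph) (Δ : Fin s → Finset α)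
    (i : ℕ) : (⊤ : SimpleGraph α).Subgraph :=
  H ⊔ ⨆ j : Fin s, ⨆ _ : (j : ℕ) < i, triangleGraph (Δ j)

/-- An activation process `(H; Δ₁, …, Δₛ)`, with triangles indexed from `0`: each triangle adds
exactly one edge to the union of `H` and of the earlier triangles. -/
structure ActivationProcess (α : Type*) where
  H : (⊤ : SimpleGraph α).Subgraph
  s : ℕ
  Δ : Fin s → Finset α
  card_eq_three : ∀ k, (Δ k).card = 3
  existsUnique_new : ∀ k : Fin s,
    ∃! e : Sym2 α, e ∈ (triangleGraph (Δ k)).edgeSet \ (stageGraph H Δ k).edgeSet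

namespace ActivationProcess

/-- The graph `H ∪ Δ 0 ∪ ⋯ ∪ Δ (i - 1)` reached after `i` activations. -/
def stage {α : Type*} (A : ActivationProcess α) (i : ℕ) : (⊤ : SimpleGraph α).Subgraph :=
  stageGraph A.H A.Δ i

/-- The final graph of the process; it is the 1-skeleton of the activation complex `K(A)`. -/
def finalGraph {α : Type*} (A : ActivationProcess α) : (⊤ : SimpleGraph α).Subgraph :=
  A.stage A.s

/-- `H` activates `G'` via the process `A`. -/
def Activates {α : Type*} (A : ActivationProcess α) (G' : (⊤ : SimpleGraph α).Subgraph) : Prop :=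
  G' ≤ A.finalGraph

/-- The triangle `Δ k` activates the edge `e`. -/
def ActivatesAt {α : Type*} (A : ActivationProcess α) (k : Fin A.s) (e : Sym2 α) : Prop :=
  e ∈ (triangleGraph (A.Δ k)).edgeSet \ (A.stage k).edgeSet

/-- The contribution of an edge: the number of triangles that contain it without activating it. -/
def con {α : Type*} (A : ActivationProcess α) (e : Sym2 α) : ℕ :=
  Set.ncard {k : Fin A.s | e ∈ (triangleGraph (A.Δ k)).edgeSet ∧ ¬ A.ActivatesAt k e}

open Classical in
/-- The excess of an edge, relative to the activated graph `G'`. -/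
def edgeExc {α : Type*} (A : ActivationProcess α) (G' : (⊤ : SimpleGraph α).Subgraph)
    (e : Sym2 α) : ℤ :=
  if e ∈ G'.edgeSet \ A.H.edgeSet then (A.con e : ℤ)
  else if e ∈ A.H.edgeSet \ G'.edgeSet then (A.con e : ℤ) - 2
  else (A.con e : ℤ) - 1

open Classical in
/-- The excess of the process: the sum of the excesses of all edges of `K(A)`. -/
def exc {α : Type*} [Fintype α] (A : ActivationProcess α)
    (G' : (⊤ : SimpleGraph α).Subgraph) : ℤ :=
  ∑ e ∈ A.finalGraph.edgeSet.toFinset, A.edgeExc G' e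

/-- A process is nice if every edge of `K(A)` has non-negative excess. -/
def IsNice {α : Type*} (A : ActivationProcess α) (G' : (⊤ : SimpleGraph α).Subgraph) : Prop :=
  ∀ e ∈ A.finalGraph.edgeSet, 0 ≤ A.edgeExc G' e

end ActivationProcess

/-- The complexity `|E(H)| - |V(H)| + 1` of a finite graph. -/
def graphComplexity {α : Type*} (H : (⊤ : SimpleGraph α).Subgraph) : ℤ :=
  (H.edgeSet.ncard : ℤ) - (H.verts.ncard : ℤ) + 1

/-- The graph `C` is a cycle of length `ℓ` (meant for `3 ≤ ℓ`). -/
def IsCycleGraphOfLength {α : Type*} (C : (⊤ : SimpleGraph α).Subgraph) (ℓ : ℕ) : Prop :=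
  Nonempty (C.coe ≃g SimpleGraph.cycleGraph ℓ)

/-! ### Labelled complexes -/

/-- An abstract simplicial complex whose vertices carry labels from `α`; different vertices may
carry the same label. -/
structure LabelledComplex (α : Type*) where
  V : Type
  complex : AbstractSimplicialComplex V
  label : V → α

/-- A bijection of the vertices that preserves faces in both directions and preserves labels. -/
structure LabelledComplex.Iso {α : Type*} (D D' : LabelledComplex α) where
  toEquiv : D.V ≃ D'.V
  face_iff : ∀ S : Finset D.V, S.map toEquiv.toEmbedding ∈ D'.complex ↔ S ∈ D.complex
  label_eq : ∀ x : D.V, D'.label (toEquiv x) = D.label x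

/-- Labelled complexes are identified when there is a label-preserving isomorphism. -/
instance LabelledComplex.setoid (α : Type*) : Setoid (LabelledComplex α) where
  r D D' := Nonempty (D.Iso D')
  iseqv :=
    { refl := fun D => ⟨⟨Equiv.refl _, fun S => by simp, fun _ => rfl⟩⟩
      symm := by
        rintro D D' ⟨f⟩
        refine ⟨⟨f.toEquiv.symm, fun S => ?_, fun x => ?_⟩⟩
        · rw [← f.face_iff, Finset.map_map]
          have h : (f.toEquiv.symm.toEmbedding.trans f.toEquiv.toEmbedding) =
              Function.Embedding.refl _ := by ext x; simp
          rw [h, Finset.map_refl]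
        · rw [← f.label_eq]; simp
      trans := by
        rintro D D' D'' ⟨f⟩ ⟨g⟩
        refine ⟨⟨f.toEquiv.trans g.toEquiv, fun S => ?_, fun x => ?_⟩⟩
        · rw [← f.face_iff, ← g.face_iff, Finset.map_map]; rfl
        · simp [g.label_eq, f.label_eq] }

/-- A labelled complex together with a set of marked edges. -/
structure MarkedComplex (α : Type*) extends LabelledComplex α where
  marked : Set (Sym2 V)

/-- A graph, as a 1-dimensional complex whose vertices are labelled by themselves and all of whose
edges are marked. -/
def MarkedComplex.ofGraph {n : ℕ} (C : (⊤ : SimpleGraph (Fin n)).Subgraph) :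
    MarkedComplex (Fin n) where
  V := C.verts
  complex :=
    { faces := {S | S.Nonempty ∧ ∀ x ∈ S, ∀ y ∈ S, x ≠ y → (C.coe.Adj x y ∧ S.card = 2)}
      isRelLowerSet_faces := by
        rintro S ⟨hS, h⟩
        refine ⟨hS, fun T hTS hT => ⟨hT, fun x hx y hy hxy => ?_⟩⟩
        obtain ⟨hadj, hcard⟩ := h x (hTS hx) y (hTS hy) hxy
        exact ⟨hadj, le_antisymm (hcard ▸ Finset.card_le_card hTS)
          (Finset.one_lt_card.2 ⟨x, hx, y, hy, hxy⟩)⟩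
      singleton_mem := fun v => by
        refine ⟨Finset.singleton_nonempty v, fun x hx y hy hxy => ?_⟩
        rw [Finset.mem_singleton] at hx hy
        exact absurd (hx.trans hy.symm) hxy }
  label := Subtype.val
  marked := C.coe.edgeSet

/-- Glue to the edge `{a, b}` of `D` a triangle whose third vertex `none` is new and has the label
`y`. The edge `{a, b}` is unmarked; for `x = a, b` the new edge `{x, none}` is marked if `D` has no
marked edge whose ends have the labels `label x` and `y`. -/
def MarkedComplex.glue {α : Type*} (D : MarkedComplex α) (a b : D.V) (y : α) :
    MarkedComplex α where
  V := Option D.V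
  complex :=
    { faces := {S | (∃ T ∈ D.complex, S = T.map Function.Embedding.some) ∨
        (S.Nonempty ∧ ∀ x ∈ S, x = none ∨ x = some a ∨ x = some b)}
      isRelLowerSet_faces := by
        rintro S (⟨T, hT, rfl⟩ | ⟨hS, h⟩)
        · have hTl := D.complex.isRelLowerSet_faces hT
          refine ⟨hTl.1.map, fun R hR hRne => Or.inl ?_⟩
          obtain ⟨U, hU, rfl⟩ := Finset.subset_map_iff.1 hR
          exact ⟨U, hTl.2 hU (Finset.map_nonempty.1 hRne), rfl⟩
        · exact ⟨hS, fun R hR hRne => Or.inr ⟨hRne, fun x hx => h x (hR hx)⟩⟩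
      singleton_mem := fun v => by
        cases v with
        | none => exact Or.inr ⟨Finset.singleton_nonempty _, fun x hx =>
            Or.inl (Finset.mem_singleton.1 hx)⟩
        | some v => exact Or.inl ⟨{v}, D.complex.singleton_mem v, by simp⟩ }
  label := fun x => x.elim y D.label
  marked := Sym2.map some '' (D.marked \ {s(a, b)}) ∪
    {e | ∃ x, (x = a ∨ x = b) ∧ e = s(some x, none) ∧
      ∀ f ∈ D.marked, Sym2.map D.label f ≠ s(D.label x, y)}

/-! ### Activation diagrams -/

/-- `A.IsPartialDiagram C i D` says that `D` arises from the cycle `C` by gluing the triangles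
`Δ (s - 1), …, Δ i`, in this order, each of them to the unique marked edge that carries the labels
of the edge that it activates. -/
inductive ActivationProcess.IsPartialDiagram {n : ℕ} (A : ActivationProcess (Fin n))
    (C : (⊤ : SimpleGraph (Fin n)).Subgraph) : ℕ → MarkedComplex (Fin n) → Prop
  | start : A.IsPartialDiagram C A.s (MarkedComplex.ofGraph C)
  | glue (k : Fin A.s) (D : MarkedComplex (Fin n)) (a b : D.V) (y : Fin n)
      (hD : A.IsPartialDiagram C ((k : ℕ) + 1) D)
      (hmarked : s(a, b) ∈ D.marked)
      (hactivates : A.ActivatesAt k s(D.label a, D.label b))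
      (hunique : ∀ f ∈ D.marked,
        Sym2.map D.label f = s(D.label a, D.label b) → f = s(a, b))
      (htriangle : A.Δ k = {D.label a, D.label b, y}) :
      A.IsPartialDiagram C k (D.glue a b y)

/-- `D` is the `A`-activation diagram of the cycle `C`, the marks being forgotten. -/
def ActivationProcess.IsActivationDiagram {n : ℕ} (A : ActivationProcess (Fin n))
    (C : (⊤ : SimpleGraph (Fin n)).Subgraph) (D : LabelledComplex (Fin n)) : Prop :=
  ∃ D₁ : MarkedComplex (Fin n), A.IsPartialDiagram C 0 D₁ ∧ D = D₁.toLabelledComplex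

/-- The collection `P_{v,w}(ℓ,n)` of all activation diagrams, up to label-preserving isomorphism,
of nice activation processes `A = (H; Δ₁, …, Δₛ)` of `ℓ`-cycles, where `H` is a connected graph with
`V(H) ⊆ [n]`, `|V(H)| = v` and `2 d_H + exc A = w`. -/
def nicePDiagrams (ℓ n v w : ℕ) : Set (Quotient (LabelledComplex.setoid (Fin n))) :=
  {q | ∃ (A : ActivationProcess (Fin n)) (C : (⊤ : SimpleGraph (Fin n)).Subgraph)
      (D : LabelledComplex (Fin n)),
    IsCycleGraphOfLength C ℓ ∧ A.H.Connected ∧ A.Activates C ∧ A.IsNice C ∧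
    A.H.verts.ncard = v ∧ 2 * graphComplexity A.H + A.exc C = (w : ℤ) ∧
    A.IsActivationDiagram C D ∧ q = Quotient.mk _ D}

end

/-! ### Words in which few letters are unpredictable -/

/-! A diagram is the cycle `C` with triangulated polygons glued to its edges, so it is determined by
its boundary walk together with the way the polygons are triangulated. A binary tree records this:
the right spine is the cycle, the left subtrees are the triangulations, and the inorder traversal
runs along the boundary. Tree shape and inorder labels determine the labelled complex up to
isomorphism (`Presents.nonempty_iso`).

Each gluing removes the activated edge from the boundary and adds the two other edges of the
triangle. Hence at the end a pair `e` in `K(A)` occurs on the boundary exactly `exc e + 2` times if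
it is in `H` and `exc e` times if not (`exists_presents_zero`). Summing, the boundary has length
`exc A + 2|E(H)| = 2v + w - 2`. By niceness every edge of `H` occurs at least twice, and `H` is
connected, so at least `v - 1` pairs are repeated. Closed up by its last letter, the boundary gives
a word of length `2v + w - 1` with `v` distinct letters.

To count such words, build them by adding letters in front. A letter is new (`v` times), or
completes the second step over a pair (once per repeated pair, so at least `v - 1` times), or is one
of at most `w` others. Weights whose total is at most `5/2` at each step replace an explicit
encoding: a new letter costs `n`, an "other" letter costs at most `v^2`, and a second step costs the
number of pending pairs at the current letter. That last cost is paid by a potential, which drops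
whenever there are several pending pairs and rises by at most 2 at each "other" letter
(`pow_potential_le`). Every word therefore has weight at least `n^{-v} v^{-4w}`.

There are Catalan many shapes, at most `4^{2v+w-2}`. The resulting bound already holds without the
factor `w^w * choose`, which is at least 1. -/

/-- The pairs of consecutive letters of a word. -/
def steps {α : Type*} : List α → List (Sym2 α)
  | x :: y :: t => s(x, y) :: steps (y :: t)
  | _ => []

theorem sum_const_inv_card_le {α : Type*} (S : Finset α) : ∑ _y ∈ S, (1 / (S.card : ℝ)) ≤ 1 := by
  rw [Finset.sum_const, nsmul_eq_mul, mul_one_div]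
  exact div_self_le_one _

theorem mem_of_mem_steps {β : Type*} {h : List β} {e : Sym2 β} (he : e ∈ steps h) :
    ∀ z ∈ e, z ∈ h := by
  induction h with
  | nil => simp [steps] at he
  | cons x t ih =>
    cases t with
    | nil => simp [steps] at he
    | cons y t =>
      rw [steps, List.mem_cons] at he
      rcases he with rfl | he
      · intro z hz
        rcases Sym2.mem_iff.1 hz with rfl | rfl <;> simp
      · exact fun z hz => List.mem_cons_of_mem _ (ih he z hz)

theorem count_steps_eq_zero {α : Type*} [DecidableEq α] {h : List α} {x y : α} (hy : y ∉ h) :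
    (steps h).count s(x, y) = 0 :=
  List.count_eq_zero.2 fun he => hy (mem_of_mem_steps he y (Sym2.mem_mk_right x y))

theorem count_steps_cons {α : Type*} [DecidableEq α] (x y : α) (t : List α) (e : Sym2 α) :
    (steps (y :: x :: t)).count e =
      (steps (x :: t)).count e + if s(x, y) = e then 1 else 0 := by
  rw [steps, List.count_cons, Sym2.eq_swap]
  simp [beq_iff_eq]

theorem count_steps_cons' {α : Type*} [DecidableEq α] (x y : α) (t : List α) (e : Sym2 α) :
    (steps (y :: x :: t)).count e =
      (steps (x :: t)).count e + if s(y, x) = e then 1 else 0 := by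
  rw [count_steps_cons, Sym2.eq_swap]

section Words

variable {α : Type*} [Fintype α] [DecidableEq α]

/-- The letters `y` for which the word steps between `x` and `y` exactly once. -/
def pending (h : List α) (x : α) : Finset α :=
  Finset.univ.filter fun y => (steps h).count s(x, y) = 1

/-- The pairs between which the word steps at least twice. -/
def repeated (h : List α) : Finset (Sym2 α) :=
  Finset.univ.filter fun e => 2 ≤ (steps h).count e

/-- The weight of the letter `y` put in front of the word. -/
noncomputable def letterWeight (v : ℕ) : List α → α → ℝ
  | [], _ => 1 / Fintype.card α
  | x :: t, y =>
    if y ∉ x :: t then 1 / Fintype.card α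
    else if y ∈ pending (x :: t) x then 1 / (pending (x :: t) x).card
    else 1 / (v * (x :: t).toFinset.card)

/-- The product of the weights of the letters of a word. -/
noncomputable def wordWeight (v : ℕ) : List α → ℝ
  | [] => 1
  | y :: h => letterWeight v h y * wordWeight v h

/-- The number of letters that are neither new nor reached through a pair stepped once before. -/
def others : List α → ℕ
  | [] => 0
  | [_] => 0
  | y :: x :: t =>
    others (x :: t) + if y ∉ x :: t ∨ y ∈ pending (x :: t) x then 0 else 1

/-- A potential that bounds how often an ambiguous choice of a pending pair can still occur. -/
def potential : List α → ℕ
  | [] => 0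
  | x :: t => ∑ y, ((pending (x :: t) y).card - if y = x then 1 else 2)

/-- The words of a given length. -/
def wordsOfLength (α : Type*) [Fintype α] [DecidableEq α] : ℕ → Finset (List α)
  | 0 => {[]}
  | k + 1 => (Finset.univ ×ˢ wordsOfLength α k).image fun p => p.1 :: p.2

theorem mem_wordsOfLength {k : ℕ} {h : List α} : h ∈ wordsOfLength α k ↔ h.length = k := by
  induction k generalizing h with
  | zero => simp [wordsOfLength]
  | succ k ih =>
    cases h with
    | nil => simp [wordsOfLength]
    | cons y t => simp [wordsOfLength, ih]

/-! ### Total weight of all words of a given length. -/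

theorem letterWeight_nonneg (v : ℕ) (h : List α) (y : α) : 0 ≤ letterWeight v h y := by
  cases h with
  | nil => simp only [letterWeight]; positivity
  | cons x t => simp only [letterWeight]; split_ifs <;> positivity

theorem wordWeight_nonneg (v : ℕ) (h : List α) : 0 ≤ wordWeight v h := by
  induction h with
  | nil => simp [wordWeight]
  | cons y h ih => exact mul_nonneg (letterWeight_nonneg v h y) ih

/-- New letters and pending letters each have total weight at most 1, the remaining ones at most `1
/ v ≤ 1 / 2`. -/
theorem sum_letterWeight_le {v : ℕ} (hv : 2 ≤ v) (h : List α) :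
    ∑ y, letterWeight v h y ≤ 5 / 2 := by
  have hα : ∑ _y : α, (1 / (Fintype.card α : ℝ)) ≤ 1 := sum_const_inv_card_le Finset.univ
  cases h with
  | nil => simp only [letterWeight]; linarith
  | cons x t =>
    have h1 : ∀ y, letterWeight v (x :: t) y ≤ 1 / (Fintype.card α : ℝ) +
        (if y ∈ pending (x :: t) x then 1 / ((pending (x :: t) x).card : ℝ) else 0) +
        (if y ∈ (x :: t).toFinset then
          1 / (v : ℝ) * (1 / ((x :: t).toFinset.card : ℝ)) else 0) := by
      intro y
      have e1 : (0 : ℝ) ≤ 1 / (Fintype.card α : ℝ) := by positivity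
      have e2 : (0 : ℝ) ≤ 1 / ((pending (x :: t) x).card : ℝ) := by positivity
      have e3 : (0 : ℝ) ≤ 1 / (v : ℝ) * (1 / ((x :: t).toFinset.card : ℝ)) := by positivity
      have e4 : 1 / ((v : ℝ) * ((x :: t).toFinset.card : ℝ)) =
        1 / (v : ℝ) * (1 / ((x :: t).toFinset.card : ℝ)) := by rw [one_div_mul_one_div]
      simp only [letterWeight, List.mem_toFinset, e4]
      by_cases c1 : y ∈ x :: t
      · by_cases c2 : y ∈ pending (x :: t) x
        · simp only [c1, c2, not_true, if_true, if_false]; linarith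
        · simp only [c1, c2, not_true, if_true, if_false]; linarith
      · by_cases c2 : y ∈ pending (x :: t) x
        · simp only [c1, c2, not_false_iff, if_true, if_false]; linarith
        · simp only [c1, c2, not_false_iff, if_true, if_false]; linarith
    have h2 : (1 : ℝ) / v ≤ 1 / 2 := by
      apply one_div_le_one_div_of_le (by norm_num)
      exact_mod_cast hv
    have h3 := sum_const_inv_card_le (pending (x :: t) x)
    have h4 := sum_const_inv_card_le (x :: t).toFinset
    have h4' := mul_le_mul_of_nonneg_left h4 (show (0 : ℝ) ≤ 1 / v by positivity)
    rw [Finset.mul_sum] at h4'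
    calc _ ≤ _ := Finset.sum_le_sum fun y _ => h1 y
      _ ≤ 5 / 2 := by
        rw [Finset.sum_add_distrib, Finset.sum_add_distrib, Finset.sum_ite_mem,
          Finset.sum_ite_mem, Finset.univ_inter, Finset.univ_inter]
        linarith

theorem sum_wordWeight_le {v : ℕ} (hv : 2 ≤ v) (k : ℕ) :
    ∑ h ∈ wordsOfLength α k, wordWeight v h ≤ (5 / 2) ^ k := by
  induction k with
  | zero => simp [wordsOfLength, wordWeight]
  | succ k ih =>
    rw [wordsOfLength, Finset.sum_image (by
      rintro ⟨a, b⟩ - ⟨c, d⟩ - h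
      simpa using h), Finset.sum_product_right, pow_succ']
    calc _ = ∑ h ∈ wordsOfLength α k, (∑ y, letterWeight v h y) * wordWeight v h := by
          refine Finset.sum_congr rfl fun h _ => ?_
          rw [Finset.sum_mul]; rfl
      _ ≤ ∑ h ∈ wordsOfLength α k, 5 / 2 * wordWeight v h :=
          Finset.sum_le_sum fun h _ => mul_le_mul_of_nonneg_right (sum_letterWeight_le hv h)
            (wordWeight_nonneg v h)
      _ ≤ _ := by
          rw [← Finset.mul_sum]
          exact mul_le_mul_of_nonneg_left ih (by norm_num)

/-! ### Evolution of pending pairs and of the potential. -/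

theorem mem_pending {h : List α} {x y : α} :
    y ∈ pending h x ↔ (steps h).count s(x, y) = 1 := by simp [pending]

theorem pending_subset (h : List α) (x : α) : pending h x ⊆ h.toFinset := by
  intro y hy
  rw [mem_pending] at hy
  by_contra hc
  rw [List.mem_toFinset] at hc
  rw [count_steps_eq_zero hc] at hy
  exact absurd hy (by norm_num)

theorem pending_eq_empty {h : List α} {x : α} (hx : x ∉ h) : pending h x = ∅ := by
  refine Finset.eq_empty_of_forall_notMem fun y hy => ?_
  rw [mem_pending, Sym2.eq_swap, count_steps_eq_zero hx] at hy
  exact absurd hy (by norm_num)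

theorem pending_cons_of_ne {x y z : α} (t : List α) (hx : z ≠ x) (hy : z ≠ y) :
    pending (y :: x :: t) z = pending (x :: t) z := by
  ext a
  rw [mem_pending, mem_pending, count_steps_cons, if_neg, add_zero]
  intro h
  have := Sym2.mem_mk_left z a
  rw [← h, Sym2.mem_iff] at this
  tauto

/-- The extended word enters only through the counts in `hc`, so this and its two companions apply
to both ends of the added step. -/
theorem pending_cons_of_count_eq_zero {h h' : List α} {x y : α}
    (hc : ∀ e, (steps h').count e = (steps h).count e + if s(x, y) = e then 1 else 0)
    (h0 : (steps h).count s(x, y) = 0) : (pending h' x).card = (pending h x).card + 1 := by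
  have : pending h' x = insert y (pending h x) := by
    ext a
    rw [Finset.mem_insert, mem_pending, mem_pending, hc]
    by_cases ha : a = y
    · subst ha; simp [h0]
    · rw [if_neg fun he => ha (Sym2.congr_right.1 he).symm]; simp [ha]
  rw [this, Finset.card_insert_of_notMem]
  rw [mem_pending]; omega

theorem pending_cons_of_count_eq_one {h h' : List α} {x y : α}
    (hc : ∀ e, (steps h').count e = (steps h).count e + if s(x, y) = e then 1 else 0)
    (h0 : (steps h).count s(x, y) = 1) : (pending h' x).card + 1 = (pending h x).card := by
  have : pending h x = insert y (pending h' x) := by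
    ext a
    rw [Finset.mem_insert, mem_pending, mem_pending, hc]
    by_cases ha : a = y
    · subst ha; simp [h0]
    · rw [if_neg fun he => ha (Sym2.congr_right.1 he).symm]; simp [ha]
  rw [this, Finset.card_insert_of_notMem]
  rw [mem_pending, hc, if_pos rfl]; omega

theorem pending_cons_of_two_le_count {h h' : List α} {x y : α}
    (hc : ∀ e, (steps h').count e = (steps h).count e + if s(x, y) = e then 1 else 0)
    (h0 : 2 ≤ (steps h).count s(x, y)) : (pending h' x).card = (pending h x).card := by
  congr 1
  ext a
  rw [mem_pending, mem_pending, hc]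
  by_cases ha : a = y
  · subst ha
    simp only [if_pos]; omega
  · rw [if_neg fun he => ha (Sym2.congr_right.1 he).symm, add_zero]

theorem sum_eq_add_add_sum {x y : α} (hxy : x ≠ y) (f : α → ℕ) :
    ∑ z, f z = f x + f y + ∑ z ∈ Finset.univ.filter (fun z => z ≠ x ∧ z ≠ y), f z := by
  rw [← Finset.sum_pair hxy, ← Finset.sum_union]
  · congr 1
    ext z; simp; tauto
  · rw [Finset.disjoint_left]
    intro z; simp; tauto

/-- The change of the potential comes from the two ends of the last step. -/
theorem exists_potential_cons {x y : α} (hxy : x ≠ y) (t : List α) :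
    ∃ R, potential (x :: t) = ((pending (x :: t) x).card - 1) + ((pending (x :: t) y).card - 2) + R
      ∧ potential (y :: x :: t) =
        ((pending (y :: x :: t) x).card - 2) + ((pending (y :: x :: t) y).card - 1) + R := by
  refine ⟨∑ z ∈ Finset.univ.filter (fun z => z ≠ x ∧ z ≠ y), ((pending (x :: t) z).card - 2),
    ?_, ?_⟩
  · rw [potential, sum_eq_add_add_sum hxy, if_pos rfl, if_neg hxy.symm]
    congr 1
    refine Finset.sum_congr rfl fun z hz => ?_
    rw [Finset.mem_filter] at hz
    rw [if_neg hz.2.1]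
  · rw [potential, sum_eq_add_add_sum hxy, if_pos rfl, if_neg hxy]
    congr 1
    refine Finset.sum_congr rfl fun z hz => ?_
    rw [Finset.mem_filter] at hz
    rw [if_neg hz.2.2, pending_cons_of_ne t hz.2.1 hz.2.2]

/-- Leaving `x` raises its allowance from 1 to 2, which absorbs its new pending pair; the one
pending pair at `y` is within the allowance of the current letter. -/
theorem potential_cons_of_notMem {x y : α} {t : List α} (hxy : x ≠ y) (hy : y ∉ x :: t) :
    potential (y :: x :: t) ≤ potential (x :: t) := by
  obtain ⟨R, h1, h2⟩ := exists_potential_cons hxy t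
  have h0 := count_steps_eq_zero (x := x) hy
  have a1 := pending_cons_of_count_eq_zero (count_steps_cons x y t) h0
  have a2 := pending_cons_of_count_eq_zero (count_steps_cons' x y t) (Sym2.eq_swap ▸ h0)
  rw [pending_eq_empty hy, Finset.card_empty] at a2
  omega

/-- At `y` the loss of a pending pair cancels the smaller allowance. At `x` the pair is lost while
the allowance grows, so an ambiguous choice costs the potential at least 1. -/
theorem potential_cons_of_mem_pending {x y : α} {t : List α} (hxy : x ≠ y)
    (hy : y ∈ pending (x :: t) x) : potential (y :: x :: t) +
      (if 2 ≤ (pending (x :: t) x).card then 1 else 0) ≤ potential (x :: t) := by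
  obtain ⟨R, h1, h2⟩ := exists_potential_cons hxy t
  have h0 := mem_pending.1 hy
  have a1 := pending_cons_of_count_eq_one (count_steps_cons x y t) h0
  have a2 := pending_cons_of_count_eq_one (count_steps_cons' x y t) (Sym2.eq_swap ▸ h0)
  split_ifs <;> omega

theorem potential_cons_of_notMem_pending {x y : α} {t : List α} (hxy : x ≠ y)
    (hy : y ∉ pending (x :: t) x) : potential (y :: x :: t) ≤ potential (x :: t) + 2 := by
  obtain ⟨R, h1, h2⟩ := exists_potential_cons hxy t
  rw [mem_pending] at hy
  rcases Nat.lt_or_gt_of_ne hy with h0 | h0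
  · rw [Nat.lt_one_iff] at h0
    have a1 := pending_cons_of_count_eq_zero (count_steps_cons x y t) h0
    have a2 := pending_cons_of_count_eq_zero (count_steps_cons' x y t) (Sym2.eq_swap ▸ h0)
    omega
  · have a1 := pending_cons_of_two_le_count (count_steps_cons x y t) h0
    have a2 := pending_cons_of_two_le_count (count_steps_cons' x y t) (Sym2.eq_swap ▸ h0)
    omega

/-- Amortised lower bound for the weight of a word: the factor `v ^ potential` is credit that pays
for later choices among pending letters. -/
theorem pow_potential_le {v : ℕ} [Nonempty α] (hv : 1 ≤ v) (h : List α)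
    (hd : ∀ e ∈ steps h, ¬ e.IsDiag) (hcard : h.toFinset.card ≤ v) :
    (v : ℝ) ^ potential h ≤
      wordWeight v h * (Fintype.card α : ℝ) ^ h.toFinset.card * (v : ℝ) ^ (4 * others h) := by
  have hn : (0 : ℝ) < Fintype.card α := by exact_mod_cast Fintype.card_pos
  have hv' : (1 : ℝ) ≤ v := by exact_mod_cast hv
  have hv0 : (0 : ℝ) < v := by linarith
  induction h with
  | nil => simp [potential, wordWeight, others]
  | cons y h ih =>
    cases h with
    | nil =>
      have : ∀ z, pending [y] z = ∅ := fun z => by ext a; simp [mem_pending, steps]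
      simp [potential, wordWeight, others, letterWeight, this, hn.ne']
    | cons x t =>
      have hxy : x ≠ y := by
        have := hd s(y, x) (by simp [steps])
        simpa [eq_comm] using this
      have hsub : (x :: t).toFinset ⊆ (y :: x :: t).toFinset := by
        rw [List.toFinset_cons (a := y)]; exact Finset.subset_insert _ _
      have hcard' : (x :: t).toFinset.card ≤ v := (Finset.card_le_card hsub).trans hcard
      have ih' := ih (fun e he => hd e (by rw [steps]; exact List.mem_cons_of_mem _ he)) hcard'
      have hdeg : (pending (x :: t) x).card ≤ v :=
        (Finset.card_le_card (pending_subset _ _)).trans hcard'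
      have hcpos : 0 < (x :: t).toFinset.card := Finset.card_pos.2 ⟨x, by simp⟩
      have hW := wordWeight_nonneg v (x :: t)
      by_cases hy : y ∈ x :: t
      · have hfin : (y :: x :: t).toFinset = (x :: t).toFinset := by
          rw [List.toFinset_cons (a := y), Finset.insert_eq_of_mem (by simpa using hy)]
        by_cases hp : y ∈ pending (x :: t) x
        · have hpot := potential_cons_of_mem_pending hxy hp
          have hdpos : 0 < (pending (x :: t) x).card := Finset.card_pos.2 ⟨y, hp⟩
          have ho : others (y :: x :: t) = others (x :: t) := by simp [others, hp]
          rw [hfin, ho, wordWeight, letterWeight, if_neg (not_not.2 hy), if_pos hp]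
          have hd' : (0 : ℝ) < (pending (x :: t) x).card := by exact_mod_cast hdpos
          rw [mul_assoc, mul_assoc, one_div_mul_eq_div, le_div_iff₀ hd', ← mul_assoc]
          refine le_trans ?_ ih'
          -- With several pending letters the drop of the potential pays for a factor `v`; with just
          -- one the choice is free.
          split_ifs at hpot with h2
          · calc (v : ℝ) ^ potential (y :: x :: t) * (pending (x :: t) x).card
                ≤ (v : ℝ) ^ potential (y :: x :: t) * v := by gcongr
              _ = (v : ℝ) ^ (potential (y :: x :: t) + 1) := by rw [pow_succ]
              _ ≤ _ := pow_le_pow_right₀ hv' hpot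
          · have : (pending (x :: t) x).card = 1 := by omega
            rw [this, Nat.cast_one, mul_one]
            exact pow_le_pow_right₀ hv' (by omega)
        · have hpot := potential_cons_of_notMem_pending hxy hp
          have ho : others (y :: x :: t) = others (x :: t) + 1 := by
            simp only [others, hp, hy, not_true, or_self, if_false]
          rw [hfin, ho, wordWeight, letterWeight, if_neg (not_not.2 hy), if_neg hp]
          have hc' : (0 : ℝ) < (x :: t).toFinset.card := by exact_mod_cast hcpos
          have hc'' : ((x :: t).toFinset.card : ℝ) ≤ v := by exact_mod_cast hcard'
          rw [mul_assoc, mul_assoc, one_div_mul_eq_div, le_div_iff₀ (by positivity)]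
          -- Two of the four factors `v` pay for the weight, the other two for the rise of the
          -- potential.
          calc (v : ℝ) ^ potential (y :: x :: t) * (v * (x :: t).toFinset.card)
              ≤ (v : ℝ) ^ (potential (x :: t) + 2) * (v * v) := by
                gcongr
            _ = (v : ℝ) ^ potential (x :: t) * v ^ 4 := by ring
            _ ≤ _ := mul_le_mul_of_nonneg_right ih' (by positivity)
            _ = _ := by ring
      · have hpot := potential_cons_of_notMem hxy hy
        have hfin : (y :: x :: t).toFinset.card = (x :: t).toFinset.card + 1 := by
          rw [List.toFinset_cons (a := y), Finset.card_insert_of_notMem (by simpa using hy)]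
        have ho : others (y :: x :: t) = others (x :: t) := by
          simp only [others, hy, not_false_iff, true_or, if_true, add_zero]
        rw [hfin, ho, wordWeight, letterWeight, if_pos hy]
        refine (pow_le_pow_right₀ hv' hpot).trans (ih'.trans_eq ?_)
        rw [pow_succ]; field_simp

/-- Each letter is counted once: as a first occurrence, as the step at which a pair becomes
repeated, or as an "other" letter. -/
theorem length_eq_card_add_card_add_others (h : List α) :
    h.length = h.toFinset.card + (repeated h).card + others h := by
  induction h with
  | nil => simp [repeated, steps, others]
  | cons y h ih =>
    cases h with
    | nil => simp [repeated, steps, others]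
    | cons x t =>
      rw [List.length_cons, ih]
      by_cases hp : y ∈ pending (x :: t) x
      · have hy : y ∈ (x :: t).toFinset := pending_subset _ _ hp
        have ho : others (y :: x :: t) = others (x :: t) := by simp [others, hp]
        have hr : repeated (y :: x :: t) = insert s(x, y) (repeated (x :: t)) := by
          ext e
          rw [mem_pending] at hp
          simp only [repeated, Finset.mem_insert, Finset.mem_filter, Finset.mem_univ, true_and,
            count_steps_cons]
          by_cases he : s(x, y) = e
          · subst he; simp [hp]
          · simp [he, Ne.symm he]
        rw [ho, hr, Finset.card_insert_of_notMem, List.toFinset_cons (a := y),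
          Finset.insert_eq_of_mem hy]
        · ring
        · rw [mem_pending] at hp; simp [repeated, hp]
      · have hr : repeated (y :: x :: t) = repeated (x :: t) := by
          ext e
          rw [mem_pending] at hp
          simp only [repeated, Finset.mem_filter, Finset.mem_univ, true_and, count_steps_cons]
          by_cases he : s(x, y) = e
          · subst he; rw [if_pos rfl]; omega
          · simp [he]
        by_cases hy : y ∈ x :: t
        · have ho : others (y :: x :: t) = others (x :: t) + 1 := by
            simp only [others, hp, hy, not_true, or_self, if_false]
          rw [hr, ho, List.toFinset_cons (a := y), Finset.insert_eq_of_mem (by simpa using hy)]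
          ring
        · have ho : others (y :: x :: t) = others (x :: t) := by
            simp only [others, hy, not_false_iff, true_or, if_true, add_zero]
          rw [hr, ho, List.toFinset_cons (a := y),
            Finset.card_insert_of_notMem (by simpa using hy)]
          ring

/-- The words of length `2 v + w - 1` with `v` different letters and no repeated consecutive
letter that step at least twice between at least `v - 1` pairs of letters. -/
def repetitiveWords (α : Type*) [Fintype α] [DecidableEq α] (v w : ℕ) : Finset (List α) :=
  (wordsOfLength α (2 * v + w - 1)).filter fun h =>
    (∀ e ∈ steps h, ¬ e.IsDiag) ∧ h.toFinset.card = v ∧ v ≤ (repeated h).card + 1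

theorem card_repetitiveWords_le {v w : ℕ} (hv : 2 ≤ v) :
    ((repetitiveWords α v w).card : ℝ) ≤
      (Fintype.card α : ℝ) ^ v * (v : ℝ) ^ (4 * w) * (5 / 2) ^ (2 * v + w - 1) := by
  have hv' : (1 : ℝ) ≤ v := by exact_mod_cast (by omega : 1 ≤ v)
  have key : ∀ h ∈ repetitiveWords α v w,
      (1 : ℝ) ≤ (Fintype.card α : ℝ) ^ v * (v : ℝ) ^ (4 * w) * wordWeight v h := by
    intro h hh
    rw [repetitiveWords, Finset.mem_filter, mem_wordsOfLength] at hh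
    obtain ⟨hl, hd, hc, hr⟩ := hh
    have hlen := length_eq_card_add_card_add_others h
    have ho : others h ≤ w := by omega
    have hne : Nonempty α := by
      cases h with
      | nil => simp at hl; omega
      | cons x t => exact ⟨x⟩
    have hpp := pow_potential_le (by omega : 1 ≤ v) h hd hc.le
    rw [hc] at hpp
    have hW := wordWeight_nonneg v h
    calc (1 : ℝ) ≤ (v : ℝ) ^ potential h := one_le_pow₀ hv'
      _ ≤ _ := hpp
      _ ≤ wordWeight v h * (Fintype.card α : ℝ) ^ v * (v : ℝ) ^ (4 * w) := by
        gcongr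
      _ = _ := by ring
  calc ((repetitiveWords α v w).card : ℝ) = ∑ _h ∈ repetitiveWords α v w, (1 : ℝ) := by simp
    _ ≤ ∑ h ∈ repetitiveWords α v w,
        (Fintype.card α : ℝ) ^ v * (v : ℝ) ^ (4 * w) * wordWeight v h := Finset.sum_le_sum key
    _ ≤ ∑ h ∈ wordsOfLength α (2 * v + w - 1),
        (Fintype.card α : ℝ) ^ v * (v : ℝ) ^ (4 * w) * wordWeight v h :=
      Finset.sum_le_sum_of_subset_of_nonneg (Finset.filter_subset _ _) fun h _ _ =>
        mul_nonneg (by positivity) (wordWeight_nonneg v h)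
    _ ≤ _ := by
      rw [← Finset.mul_sum]
      exact mul_le_mul_of_nonneg_left (sum_wordWeight_le hv _) (by positivity)

end Words

/-! ### Triangulated cycles as binary trees -/

namespace BinaryTree

variable {α β : Type*}

/-- The nodes of a tree, from left to right. -/
def inorder : BinaryTree α → List α
  | nil => []
  | node x l r => inorder l ++ x :: inorder r

/-- The pairs of neighbours in the word `lo, t.inorder, hi`. -/
def gaps (lo hi : α) : BinaryTree α → List (Sym2 α)
  | nil => [s(lo, hi)]
  | node x l r => gaps lo x l ++ gaps x hi r

/-- The triangles of a triangulated polygon with root edge `{lo, hi}`: the root of the tree is the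
third vertex of the triangle at the root edge, and the subtrees triangulate its two sides. -/
def triangles (lo hi : α) : BinaryTree α → Set (Set α)
  | nil => ∅
  | node x l r => insert {lo, x, hi} (triangles lo x l ∪ triangles x hi r)

/-- The gaps of a tree whose right spine is a path that starts next to `p`, and whose left
subtrees triangulate polygons at the edges of that path. -/
def spineGaps (p : α) : BinaryTree α → List (Sym2 α)
  | nil => []
  | node x l r => gaps p x l ++ spineGaps x r

/-- The edges of the path given by the right spine, and the triangles at these edges. -/
def spineFacets (p : α) : BinaryTree α → Set (Set α)
  | nil => ∅
  | node x l r => insert {p, x} (triangles p x l ∪ spineFacets x r)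

/-! ### Relabelling, and reconstruction of a tree from shape and inorder word. -/

theorem inorder_map (f : α → β) (t : BinaryTree α) : (t.map f).inorder = t.inorder.map f := by
  induction t with
  | nil => rfl
  | node x l r hl hr => simp [map, inorder, hl, hr]

theorem gaps_map (f : α → β) (lo hi : α) (t : BinaryTree α) :
    gaps (f lo) (f hi) (t.map f) = (gaps lo hi t).map (Sym2.map f) := by
  induction t generalizing lo hi with
  | nil => rfl
  | node x l r hl hr => simp [map, gaps, hl, hr]

theorem spineGaps_map (f : α → β) (p : α) (t : BinaryTree α) :
    spineGaps (f p) (t.map f) = (spineGaps p t).map (Sym2.map f) := by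
  induction t generalizing p with
  | nil => rfl
  | node x l r hl hr => simp [map, spineGaps, gaps_map, hr]

theorem triangles_map (f : α → β) (lo hi : α) (t : BinaryTree α) :
    triangles (f lo) (f hi) (t.map f) = Set.image f '' triangles lo hi t := by
  induction t generalizing lo hi with
  | nil => simp [map, triangles]
  | node x l r hl hr => simp [map, triangles, hl, hr, Set.image_insert_eq, Set.image_union]

theorem spineFacets_map (f : α → β) (p : α) (t : BinaryTree α) :
    spineFacets (f p) (t.map f) = Set.image f '' spineFacets p t := by
  induction t generalizing p with
  | nil => simp [map, spineFacets]
  | node x l r hl hr =>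
    simp [map, spineFacets, triangles_map, hr, Set.image_insert_eq, Set.image_union]

theorem numNodes_eq_length_inorder (t : BinaryTree α) : t.numNodes = t.inorder.length := by
  induction t with
  | nil => rfl
  | node x l r hl hr => simp [inorder, hl, hr]; ring

theorem numNodes_map (f : α → β) (t : BinaryTree α) : (t.map f).numNodes = t.numNodes := by
  rw [numNodes_eq_length_inorder, inorder_map, List.length_map, numNodes_eq_length_inorder]

theorem eq_of_inorder_eq {s t : BinaryTree α}
    (hshape : s.map (fun _ => ()) = t.map (fun _ => ())) (h : s.inorder = t.inorder) : s = t := by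
  induction s generalizing t with
  | nil =>
    cases t with
    | nil => rfl
    | node x l r => simp [map] at hshape
  | node x l r hl hr =>
    cases t with
    | nil => simp [map] at hshape
    | node x' l' r' =>
      simp only [map, node.injEq, true_and] at hshape
      have hlen : l.inorder.length = l'.inorder.length := by
        rw [← numNodes_eq_length_inorder, ← numNodes_eq_length_inorder,
          ← numNodes_map (fun _ => ()) l, hshape.1, numNodes_map]
      obtain ⟨h1, h2⟩ := List.append_inj h hlen
      rw [List.cons.injEq] at h2
      rw [h2.1, hl hshape.1 h1, hr hshape.2 h2.2]

theorem steps_cons_append_cons (p x : α) (A B : List α) :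
    steps (p :: (A ++ x :: B)) = steps (p :: (A ++ [x])) ++ steps (x :: B) := by
  induction A generalizing p with
  | nil => cases B <;> simp [steps]
  | cons a A ih => simp only [List.cons_append, steps, ih]

theorem gaps_eq_steps (lo hi : α) (t : BinaryTree α) :
    gaps lo hi t = steps (lo :: (t.inorder ++ [hi])) := by
  induction t generalizing lo hi with
  | nil => rfl
  | node x l r hl hr =>
    rw [gaps, inorder, hl, hr, List.append_assoc, List.cons_append, steps_cons_append_cons lo x l.inorder (r.inorder ++ [hi])]

theorem spineGaps_eq_steps (p : α) (t : BinaryTree α) :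
    spineGaps p t = steps (p :: t.inorder) := by
  induction t generalizing p with
  | nil => rfl
  | node x l r hl hr =>
    rw [spineGaps, inorder, gaps_eq_steps, hr, steps_cons_append_cons p x l.inorder r.inorder]

/-! ### Gluing a triangle as inserting a leaf. -/

theorem exists_insert_gaps {lo hi a b : α} (c : α) {t : BinaryTree α}
    (h : s(a, b) ∈ gaps lo hi t) : ∃ t' : BinaryTree α,
      t'.inorder.Perm (c :: t.inorder) ∧
      (s(a, b) :: gaps lo hi t').Perm (s(a, c) :: s(b, c) :: gaps lo hi t) ∧
      triangles lo hi t' = insert {a, b, c} (triangles lo hi t) := by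
  induction t generalizing lo hi with
  | nil =>
    refine ⟨node c nil nil, List.Perm.refl _, ?_, ?_⟩
    · rw [gaps, List.mem_singleton] at h
      simp only [gaps, List.singleton_append]
      rcases Sym2.eq_iff.1 h with ⟨rfl, rfl⟩ | ⟨rfl, rfl⟩
      · rw [Sym2.eq_swap (a := c)]
        exact (List.Perm.swap _ _ _).trans (List.Perm.cons _ (List.Perm.swap _ _ _))
      · rw [Sym2.eq_swap (a := c), Sym2.eq_swap (a := a) (b := b)]
        exact (List.reverse_perm [s(a, c), s(b, c), s(b, a)])
    · rw [gaps, List.mem_singleton] at h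
      simp only [triangles, Set.union_self]
      rcases Sym2.eq_iff.1 h with ⟨rfl, rfl⟩ | ⟨rfl, rfl⟩
      · rw [Set.pair_comm b c]
      · rw [Set.insert_comm a b, Set.pair_comm a c]
  | node x l r hl hr =>
    rw [gaps, List.mem_append] at h
    rcases h with h | h
    · obtain ⟨t', h1, h2, h3⟩ := hl h
      refine ⟨node x t' r, ?_, ?_, ?_⟩
      · exact h1.append_right _
      · exact h2.append_right _
      · simp only [triangles, h3, Set.insert_union]
        rw [Set.insert_comm]
    · obtain ⟨t', h1, h2, h3⟩ := hr h
      refine ⟨node x l t', ?_, ?_, ?_⟩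
      · simp only [inorder]
        exact ((h1.cons x).trans (List.Perm.swap _ _ _)).append_left _ |>.trans
          List.perm_middle
      · simp only [gaps]
        refine List.perm_middle.symm.trans ((h2.append_left _).trans ?_)
        exact List.perm_middle.trans (List.perm_middle.cons _)
      · simp only [triangles, h3, Set.union_insert]
        rw [Set.insert_comm]

/-- The new leaf always lands in the left subtree of a spine node, so the spine and its last vertex,
which closes the cycle, are unchanged. -/
theorem exists_insert_spineGaps {p a b : α} (c : α) {t : BinaryTree α}
    (h : s(a, b) ∈ spineGaps p t) : ∃ t' : BinaryTree α,
      t'.inorder.getLast? = t.inorder.getLast? ∧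
      t'.inorder.Perm (c :: t.inorder) ∧
      (s(a, b) :: spineGaps p t').Perm (s(a, c) :: s(b, c) :: spineGaps p t) ∧
      spineFacets p t' = insert {a, b, c} (spineFacets p t) := by
  induction t generalizing p with
  | nil => simp [spineGaps] at h
  | node x l r hl hr =>
    rw [spineGaps, List.mem_append] at h
    rcases h with h | h
    · obtain ⟨t', h1, h2, h3⟩ := exists_insert_gaps c h
      refine ⟨node x t' r, ?_, ?_, ?_, ?_⟩
      · simp [inorder, List.getLast?_append, List.getLast?_cons]
      · exact h1.append_right _
      · exact h2.append_right _
      · simp only [spineFacets, h3, Set.insert_union]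
        rw [Set.insert_comm]
    · obtain ⟨t', h0, h1, h2, h3⟩ := hr h
      refine ⟨node x l t', ?_, ?_, ?_, ?_⟩
      · simp [inorder, List.getLast?_append, List.getLast?_cons, h0]
      · simp only [inorder]
        exact ((h1.cons x).trans (List.Perm.swap _ _ _)).append_left _ |>.trans
          List.perm_middle
      · simp only [spineGaps]
        refine List.perm_middle.symm.trans ((h2.append_left _).trans ?_)
        exact List.perm_middle.trans (List.perm_middle.cons _)
      · simp only [spineFacets, h3, Set.union_insert]
        rw [Set.insert_comm]

/-- The tree without left subtrees and with a given right spine. -/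
def ofSpine : List α → BinaryTree α
  | [] => nil
  | x :: l => node x nil (ofSpine l)

theorem inorder_ofSpine (l : List α) : (ofSpine l).inorder = l := by
  induction l with
  | nil => rfl
  | cons x l ih => simp [ofSpine, inorder, ih]

theorem mem_spineFacets_ofSpine {p : α} {l : List α} {F : Set α} :
    F ∈ spineFacets p (ofSpine l) ↔ ∃ e ∈ steps (p :: l), F = {z | z ∈ e} := by
  induction l generalizing p with
  | nil => simp [ofSpine, spineFacets, steps]
  | cons x l ih =>
    have : {z | z ∈ s(p, x)} = ({p, x} : Set α) := by ext z; simp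
    simp only [ofSpine, spineFacets, triangles, Set.empty_union, Set.mem_insert_iff, ih, steps,
      List.mem_cons, exists_eq_or_imp, this]

end BinaryTree

/-! ### Diagrams presented by trees. -/

open BinaryTree in
/-- The complex `D` is the cycle given by the right spine of the tree `t`, which is closed by its
last vertex `p`, with triangulated polygons glued to its edges; the nodes of `t` from left to right
are the vertices of `D` along the boundary, and all marked edges are boundary edges. -/
structure Presents {α : Type*} (D : MarkedComplex α) (p : D.V) (t : BinaryTree D.V) : Prop where
  nodup : t.inorder.Nodup
  mem_inorder : ∀ x, x ∈ t.inorder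
  getLast : t.inorder.getLast? = some p
  mem_complex : ∀ S : Finset D.V, S ∈ D.complex ↔
    S.Nonempty ∧ (S.card = 1 ∨ ∃ F ∈ spineFacets p t, (S : Set D.V) ⊆ F)
  marked_subset : ∀ m ∈ D.marked, m ∈ spineGaps p t

open BinaryTree in
theorem Presents.nonempty_iso {α : Type*} {D D' : MarkedComplex α} {p : D.V} {p' : D'.V}
    {t : BinaryTree D.V} {t' : BinaryTree D'.V} (h : Presents D p t) (h' : Presents D' p' t')
    (hshape : t.map (fun _ => ()) = t'.map (fun _ => ()))
    (hlabel : t.inorder.map D.label = t'.inorder.map D'.label) :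
    Nonempty (D.toLabelledComplex.Iso D'.toLabelledComplex) := by
  classical
  have hlen : t.inorder.length = t'.inorder.length := by
    rw [← numNodes_eq_length_inorder, ← numNodes_eq_length_inorder,
      ← numNodes_map (fun _ => ()) t, hshape, numNodes_map]
  let e := h.nodup.getEquivOfForallMemList _ h.mem_inorder
  let e' := h'.nodup.getEquivOfForallMemList _ h'.mem_inorder
  let f : D.V ≃ D'.V := e.symm.trans ((finCongr hlen).trans e')
  have hf : ∀ i : Fin t.inorder.length, f (e i) = e' (finCongr hlen i) := fun i => by simp [f]
  have hin : t.inorder.map f = t'.inorder := by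
    refine List.ext_getElem (by simp [hlen]) fun i h1 h2 => ?_
    rw [List.getElem_map]
    exact hf ⟨i, by simpa using h1⟩
  have ht : t.map f = t' := by
    refine eq_of_inorder_eq ?_ ?_
    · rw [← hshape, ← comp_map]
    · rw [inorder_map, hin]
  have hp : f p = p' := by
    have := h'.getLast
    rw [← hin, List.getLast?_map, h.getLast] at this
    simpa using this
  refine ⟨⟨f, fun S => ?_, fun x => ?_⟩⟩
  · refine (h'.mem_complex _).trans (Iff.trans ?_ (h.mem_complex S).symm)
    rw [Finset.map_nonempty, Finset.card_map, ← ht, ← hp, spineFacets_map, Set.exists_mem_image,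
      Finset.coe_map]
    simp only [Equiv.coe_toEmbedding, Set.image_subset_image_iff f.injective]
  · obtain ⟨i, rfl⟩ := e.surjective x
    rw [hf]
    have h1 := List.getElem_of_eq hlabel (i := i) (by simp)
    rw [List.getElem_map, List.getElem_map] at h1
    exact h1.symm

/-- A marked edge is a boundary gap, so the new vertex `none` can be inserted there as a leaf. The
permutation statement records how the multiset of boundary labels changes. -/
theorem Presents.glue {α : Type*} {D : MarkedComplex α} {p a b : D.V} {t : BinaryTree D.V}
    (h : Presents D p t) (hab : s(a, b) ∈ D.marked) (y : α) :
    ∃ p' t', Presents (D.glue a b y) p' t' ∧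
      (s(D.label a, D.label b) ::
        (BinaryTree.spineGaps p' t').map (Sym2.map (D.glue a b y).label)).Perm
      (s(D.label a, y) :: s(D.label b, y) ::
        (BinaryTree.spineGaps p t).map (Sym2.map D.label)) := by
  classical
  have hgap : s(some a, some b) ∈ BinaryTree.spineGaps (some p) (t.map some) := by
    rw [BinaryTree.spineGaps_map]
    exact List.mem_map.2 ⟨_, h.marked_subset _ hab, rfl⟩
  obtain ⟨t', h0, h1, h2, h3⟩ := BinaryTree.exists_insert_spineGaps none hgap
  rw [BinaryTree.spineGaps_map] at h2
  rw [BinaryTree.inorder_map] at h0 h1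
  rw [BinaryTree.spineFacets_map] at h3
  have hnodup : t'.inorder.Nodup := by
    rw [h1.nodup_iff, List.nodup_cons]
    exact ⟨by simp, h.nodup.map (Option.some_injective _)⟩
  have hmem : ∀ x, x ∈ t'.inorder := by
    rintro (_ | x)
    · exact h1.mem_iff.2 (by simp)
    · exact h1.mem_iff.2 (List.mem_cons_of_mem _ (List.mem_map_of_mem (h.mem_inorder x)))
  have hlast : t'.inorder.getLast? = some (some p) := by
    rw [h0, List.getLast?_map, h.getLast]; rfl
  have hface : ∀ S : Finset (Option D.V), ((∃ T ∈ D.complex, S = T.map Function.Embedding.some) ∨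
      (S.Nonempty ∧ ∀ x ∈ S, x = none ∨ x = some a ∨ x = some b)) ↔ S.Nonempty ∧
        (S.card = 1 ∨ ∃ F ∈ BinaryTree.spineFacets (some p) t', (S : Set (Option D.V)) ⊆ F) := by
    intro S
    rw [h3]
    constructor
    · rintro (⟨T, hT, rfl⟩ | ⟨hS, hsub⟩)
      · obtain ⟨hne, hT⟩ := (h.mem_complex T).1 hT
        refine ⟨hne.map, ?_⟩
        rcases hT with hT | ⟨F, hF, hTF⟩
        · exact Or.inl (by rw [Finset.card_map, hT])
        · refine Or.inr ⟨some '' F, Or.inr ⟨F, hF, rfl⟩, ?_⟩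
          rw [Finset.coe_map]
          exact Set.image_mono hTF
      · refine ⟨hS, Or.inr ⟨_, Or.inl rfl, fun x hx => ?_⟩⟩
        rcases hsub x hx with rfl | rfl | rfl <;> simp
    · rintro ⟨hne, hS | ⟨F, hF | ⟨F, hF, rfl⟩, hSF⟩⟩
      · obtain ⟨x, rfl⟩ := Finset.card_eq_one.1 hS
        cases x with
        | none => exact Or.inr ⟨hne, by simp⟩
        | some x => exact Or.inl ⟨{x}, D.complex.singleton_mem x, by simp⟩
      · subst hF
        refine Or.inr ⟨hne, fun x hx => ?_⟩
        have := hSF hx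
        simp only [Set.mem_insert_iff, Set.mem_singleton_iff] at this
        tauto
      · left
        have hS : ∃ T : Finset D.V, S = T.map Function.Embedding.some := by
          refine ⟨S.eraseNone, ?_⟩
          ext x
          cases x with
          | none =>
            constructor
            · intro hx
              obtain ⟨z, -, hz⟩ := hSF hx
              cases hz
            · simp
          | some x => simp
        obtain ⟨T, rfl⟩ := hS
        refine ⟨T, (h.mem_complex T).2 ⟨Finset.map_nonempty.1 hne, Or.inr ⟨F, hF, ?_⟩⟩, rfl⟩
        rw [Finset.coe_map] at hSF
        exact (Set.image_subset_image_iff (Option.some_injective _)).1 hSF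
  have hperm := h2.map (Sym2.map fun x : Option D.V => x.elim y D.label)
  simp only [List.map_cons, Sym2.map_mk, List.map_map, Option.elim_some, Option.elim_none,
    ← Sym2.map_comp] at hperm
  refine ⟨some p, t', ⟨hnodup, hmem, hlast, hface, ?_⟩, hperm⟩
  · rintro m (⟨m, ⟨hm, hne⟩, rfl⟩ | ⟨x, hx, rfl, -⟩)
    · have hmem : Sym2.map some m ∈ s(some a, some b) :: BinaryTree.spineGaps (some p) t' :=
        h2.mem_iff.2 (List.mem_cons_of_mem _ (List.mem_cons_of_mem _
          (List.mem_map_of_mem (h.marked_subset m hm))))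
      -- Only the glued edge leaves the boundary, and it has been unmarked.
      refine (List.mem_cons.1 hmem).resolve_left fun heq => hne ?_
      exact Sym2.map.injective (Option.some_injective _) heq
    · have hmem : s(some x, none) ∈ s(some a, some b) :: BinaryTree.spineGaps (some p) t' := by
        refine h2.mem_iff.2 ?_
        rcases hx with rfl | rfl <;> simp
      refine (List.mem_cons.1 hmem).resolve_left fun heq => ?_
      simp at heq

/-! ### The boundary of an activation diagram -/

theorem steps_ofFn {β : Type*} {k : ℕ} (g : Fin (k + 1) → β) :
    steps (List.ofFn g) = List.ofFn fun i : Fin k => s(g i.castSucc, g i.succ) := by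
  induction k with
  | zero => simp [steps]
  | succ k ih =>
    rw [List.ofFn_succ, List.ofFn_succ, steps, List.ofFn_succ (n := k)]
    congr 1
    rw [← List.ofFn_succ (f := fun i => g i.succ), ih]
    rfl

open Classical in
theorem exists_presents_ofGraph {n ℓ : ℕ} {C : (⊤ : SimpleGraph (Fin n)).Subgraph}
    (hC : IsCycleGraphOfLength C ℓ) (hℓ : 3 ≤ ℓ) :
    ∃ p t, Presents (MarkedComplex.ofGraph C) p t ∧ ∀ e,
      ((BinaryTree.spineGaps p t).map (Sym2.map (MarkedComplex.ofGraph C).label)).count e =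
        if e ∈ C.edgeSet then 1 else 0 := by
  obtain ⟨φ⟩ := hC
  obtain ⟨m, rfl⟩ : ∃ m, ℓ = m + 3 := ⟨ℓ - 3, by omega⟩
  let g : Fin (m + 3) → C.verts := φ.symm
  have hginj : Function.Injective g := φ.symm.injective
  have hadj : ∀ i j, C.coe.Adj (g i) (g j) ↔ i - j = 1 ∨ j - i = 1 := fun i j => by
    rw [← SimpleGraph.cycleGraph_adj]
    exact φ.symm.map_adj_iff
  let p : C.verts := g (Fin.last _)
  let t : BinaryTree C.verts := BinaryTree.ofSpine (List.ofFn g)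
  have hin : t.inorder = List.ofFn g := BinaryTree.inorder_ofSpine _
  -- Indices are cyclic: `p` is `g (-1)`, so the first gap is the edge that closes the cycle.
  have hgaps : BinaryTree.spineGaps p t = List.ofFn fun i => s(g (i - 1), g i) := by
    rw [BinaryTree.spineGaps_eq_steps, hin,
      show p :: List.ofFn g = List.ofFn (Fin.cons p g : Fin (m + 4) → C.verts) by
        rw [List.ofFn_succ (n := m + 3)]; simp, steps_ofFn]
    congr 1
    funext i
    rw [Fin.cons_succ]
    congr 2
    refine Fin.cases ?_ (fun j => ?_) i
    · rw [Fin.castSucc_zero, Fin.cons_zero, zero_sub]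
      exact congrArg g (eq_neg_of_add_eq_zero_left (Fin.last_add_one (m + 2)))
    · rw [← Fin.succ_castSucc, Fin.cons_succ, ← Fin.coeSucc_eq_succ, add_sub_cancel_right]
  have hmem : ∀ e, e ∈ BinaryTree.spineGaps p t ↔ e ∈ C.coe.edgeSet := by
    intro e
    rw [hgaps, List.mem_ofFn']
    constructor
    · rintro ⟨i, rfl⟩
      rw [SimpleGraph.mem_edgeSet, hadj]
      right; abel
    · induction e with | _ x y => ?_
      obtain ⟨i, rfl⟩ := φ.symm.surjective x
      obtain ⟨j, rfl⟩ := φ.symm.surjective y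
      intro h
      rcases (hadj i j).1 h with h | h
      · refine ⟨i, ?_⟩
        beta_reduce
        rw [← h, sub_sub_cancel, Sym2.eq_swap]
      · refine ⟨j, ?_⟩
        beta_reduce
        rw [← h, sub_sub_cancel]
  have hnd : t.inorder.Nodup := by
    rw [hin]; exact List.nodup_ofFn.2 hginj
  have hall : ∀ x, x ∈ t.inorder := by
    intro x
    rw [hin, List.mem_ofFn']
    exact φ.symm.surjective x
  have hlast : t.inorder.getLast? = some p := by
    rw [hin, List.getLast?_eq_getElem?, List.length_ofFn, Nat.add_sub_cancel (m + 2) 1,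
      List.getElem?_ofFn, dif_pos (by omega)]
    rfl
  have hface : ∀ S : Finset C.verts,
      (S.Nonempty ∧ ∀ x ∈ S, ∀ y ∈ S, x ≠ y → (C.coe.Adj x y ∧ S.card = 2)) ↔ S.Nonempty ∧
        (S.card = 1 ∨ ∃ F ∈ BinaryTree.spineFacets p t, (S : Set C.verts) ⊆ F) := by
    intro S
    refine and_congr_right fun hne => ?_
    have hfacets : ∀ F, F ∈ BinaryTree.spineFacets p t ↔
        ∃ e ∈ C.coe.edgeSet, F = {z | z ∈ e} := fun F => by
      rw [BinaryTree.mem_spineFacets_ofSpine, ← hin, ← BinaryTree.spineGaps_eq_steps]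
      simp only [hmem]
    simp only [hfacets]
    constructor
    · intro h
      by_cases h1 : S.card = 1
      · exact Or.inl h1
      · have h2 : 1 < S.card := by
          have := hne.card_pos
          omega
        obtain ⟨x, hx, y, hy, hxy⟩ := Finset.one_lt_card.1 h2
        obtain ⟨ha, hc⟩ := h x hx y hy hxy
        refine Or.inr ⟨_, ⟨s(x, y), ha, rfl⟩, ?_⟩
        have : ({x, y} : Finset C.verts) = S := Finset.eq_of_subset_of_card_le
          (by intro z hz; simp at hz; rcases hz with rfl | rfl <;> assumption)
          (by rw [hc, Finset.card_pair hxy])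
        intro z hz
        rw [← this] at hz
        simpa using hz
    · rintro (h | ⟨_, ⟨e, he, rfl⟩, hS⟩)
      · intro x hx y hy hxy
        exact absurd (Finset.card_le_one.1 h.le x hx y hy) hxy
      · intro x hx y hy hxy
        have hex := hS hx
        have hey := hS hy
        have : e = s(x, y) := (Sym2.mem_and_mem_iff hxy).1 ⟨hex, hey⟩
        subst this
        refine ⟨he, le_antisymm ?_ (Finset.one_lt_card.2 ⟨x, hx, y, hy, hxy⟩)⟩
        rw [← Finset.card_pair hxy]
        refine Finset.card_le_card fun z hz => ?_
        have := hS hz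
        simpa using this
  have hgnd : (BinaryTree.spineGaps p t).Nodup := by
    rw [hgaps]
    refine List.nodup_ofFn.2 fun i j hij => ?_
    -- The swapped case would force `2 = 0` modulo `m + 3`, impossible for a cycle of length at
    -- least 3.
    rcases Sym2.eq_iff.1 hij with ⟨-, h⟩ | ⟨h1, h2⟩
    · exact hginj h
    · have h1 := hginj h1
      have h2 := hginj h2
      rw [h2, sub_sub, sub_eq_self, Fin.ext_iff] at h1
      exact absurd h1 (by simp [Fin.val_add, Nat.mod_eq_of_lt (show 2 < m + 3 by omega)])
  refine ⟨p, t, ⟨hnd, hall, hlast, hface, fun m hm => (hmem m).2 hm⟩, fun e => ?_⟩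
  refine ((hgnd.map (Sym2.map.injective Subtype.val_injective)).count).trans ?_
  refine if_congr ?_ rfl rfl
  rw [List.mem_map]
  constructor
  · rintro ⟨f, hf, rfl⟩
    rw [hmem] at hf
    induction f with | _ x y => exact hf
  · intro he
    induction e with | _ x y => ?_
    have he' : C.Adj x y := he
    exact ⟨s(⟨x, C.edge_vert he'⟩, ⟨y, C.edge_vert he'.symm⟩), (hmem _).2 he', rfl⟩

theorem mem_edgeSet_triangleGraph {α : Type*} {Δ : Finset α} {x y : α} :
    s(x, y) ∈ (triangleGraph Δ).edgeSet ↔ x ∈ Δ ∧ y ∈ Δ ∧ x ≠ y := by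
  simp [triangleGraph]

theorem ncard_le_and {s : ℕ} (k : Fin s) (P : Fin s → Prop) [Decidable (P k)] :
    {j : Fin s | (k : ℕ) ≤ j ∧ P j}.ncard =
      {j : Fin s | (k : ℕ) + 1 ≤ j ∧ P j}.ncard + if P k then 1 else 0 := by
  split_ifs with hk
  · rw [← Set.ncard_insert_of_notMem (a := k) (by simp)]
    congr 1
    ext j
    simp only [Set.mem_ofPred_eq, Set.mem_insert_iff]
    constructor
    · rintro ⟨h1, h2⟩
      rcases eq_or_ne j k with h | h
      · exact Or.inl h
      · exact Or.inr ⟨by have := Fin.val_ne_of_ne h; omega, h2⟩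
    · rintro (rfl | ⟨h1, h2⟩)
      · exact ⟨le_rfl, hk⟩
      · exact ⟨by omega, h2⟩
  · rw [add_zero]
    congr 1
    ext j
    simp only [Set.mem_ofPred_eq]
    constructor
    · rintro ⟨h1, h2⟩
      have : j ≠ k := by rintro rfl; exact hk h2
      exact ⟨by have := Fin.val_ne_of_ne this; omega, h2⟩
    · exact fun ⟨h1, h2⟩ => ⟨by omega, h2⟩

namespace ActivationProcess

open Classical in
/-- Every label occurs on the boundary as often as it was created minus as often as it was glued. -/
theorem IsPartialDiagram.exists_presents {n ℓ : ℕ} {A : ActivationProcess (Fin n)}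
    {C : (⊤ : SimpleGraph (Fin n)).Subgraph} (hC : IsCycleGraphOfLength C ℓ) (hℓ : 3 ≤ ℓ) {k : ℕ}
    {D : MarkedComplex (Fin n)} (h : A.IsPartialDiagram C k D) :
    ∃ p t, Presents D p t ∧ ∀ e,
      ((BinaryTree.spineGaps p t).map (Sym2.map D.label)).count e +
        {j : Fin A.s | k ≤ j ∧ A.ActivatesAt j e}.ncard =
      (if e ∈ C.edgeSet then 1 else 0) +
        {j : Fin A.s | k ≤ j ∧
          (e ∈ (triangleGraph (A.Δ j)).edgeSet ∧ ¬ A.ActivatesAt j e)}.ncard := by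
  induction h with
  | start =>
    obtain ⟨p, t, hP, hcount⟩ := exists_presents_ofGraph hC hℓ
    refine ⟨p, t, hP, fun e => ?_⟩
    have h0 : ∀ P : Fin A.s → Prop,
        {j : Fin A.s | A.s ≤ j ∧ P j}.ncard = 0 := fun P => by
      rw [Set.ncard_eq_zero]
      exact Set.eq_empty_of_forall_notMem fun j hj => absurd j.2 (not_lt.2 hj.1)
    rw [h0 fun j => A.ActivatesAt j e,
      h0 fun j => e ∈ (triangleGraph (A.Δ j)).edgeSet ∧ ¬ A.ActivatesAt j e, hcount]
  | glue k D a b y hD hmarked hactivates hunique htriangle ih =>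
    obtain ⟨p, t, hP, hcount⟩ := ih
    obtain ⟨p', t', hP', hperm⟩ := hP.glue hmarked y
    refine ⟨p', t', hP', fun e => ?_⟩
    have hp := hperm.count_eq e
    have hact : ∀ e, A.ActivatesAt k e ↔ s(D.label a, D.label b) = e := by
      intro e
      obtain ⟨e₀, -, h2⟩ := A.existsUnique_new k
      constructor
      · exact fun he => (h2 _ hactivates).trans (h2 _ he).symm
      · rintro rfl; exact hactivates
    have hc3 := A.card_eq_three k
    rw [htriangle] at hc3
    obtain ⟨hab, hay, hby⟩ : D.label a ≠ D.label b ∧ D.label a ≠ y ∧ D.label b ≠ y := by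
      refine ⟨?_, ?_, ?_⟩ <;> intro hh <;> rw [hh] at hc3
      · have := Finset.card_le_two (a := D.label b) (b := y)
        simp at hc3; omega
      · have := Finset.card_le_two (a := D.label b) (b := y)
        rw [Finset.insert_comm, Finset.pair_comm] at hc3
        simp at hc3; omega
      · have := Finset.card_le_two (a := D.label a) (b := y)
        simp at hc3; omega
    -- The pairs that the triangle contains without activating are exactly the labels of the two
    -- edges that the gluing adds to the boundary.
    have hpas : (if e ∈ (triangleGraph (A.Δ k)).edgeSet ∧ ¬ A.ActivatesAt k e then 1 else 0) =
        (if s(D.label a, y) = e then 1 else 0) + (if s(D.label b, y) = e then 1 else 0) := by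
      rw [hact, htriangle]
      have hne : s(D.label a, y) ≠ s(D.label b, y) := fun hh => hab (Sym2.congr_left.1 hh)
      have hn1 : s(D.label a, D.label b) ≠ s(D.label a, y) := fun hh => hby (Sym2.congr_right.1 hh)
      have hn2 : s(D.label a, D.label b) ≠ s(D.label b, y) := fun hh => by
        rw [Sym2.eq_swap] at hh; exact hay (Sym2.congr_right.1 hh)
      by_cases h1 : s(D.label a, y) = e
      · subst h1
        rw [if_pos rfl, if_neg hne.symm, if_pos]
        exact ⟨mem_edgeSet_triangleGraph.2 ⟨by simp, by simp, hay⟩, hn1⟩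
      · by_cases h2 : s(D.label b, y) = e
        · subst h2
          rw [if_pos rfl, if_neg hne, if_pos]
          exact ⟨mem_edgeSet_triangleGraph.2 ⟨by simp, by simp, hby⟩, hn2⟩
        · rw [if_neg h1, if_neg h2, if_neg]
          rintro ⟨h3, h4⟩
          induction e with | _ u w => ?_
          obtain ⟨hu, hw, huw⟩ := mem_edgeSet_triangleGraph.1 h3
          simp only [Finset.mem_insert, Finset.mem_singleton] at hu hw
          simp only [Sym2.eq_iff] at h1 h2 h4
          rcases hu with rfl | rfl | rfl <;> rcases hw with rfl | rfl | rfl <;> simp_all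
    simp only [List.count_cons, beq_iff_eq] at hp
    have hc := hcount e
    rw [ncard_le_and k fun j => A.ActivatesAt j e, ncard_le_and k fun j =>
      e ∈ (triangleGraph (A.Δ j)).edgeSet ∧ ¬ A.ActivatesAt j e, hpas]
    simp only [hact]
    omega

end ActivationProcess

/-! ### Counting activation diagrams -/

theorem steps_map {α β : Type*} (f : α → β) (h : List α) :
    steps (h.map f) = (steps h).map (Sym2.map f) := by
  induction h with
  | nil => rfl
  | cons x t ih =>
    cases t with
    | nil => rfl
    | cons y t =>
      simp only [List.map_cons, steps, Sym2.map_mk] at ih ⊢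
      rw [ih]

namespace ActivationProcess

variable {α : Type*}

theorem mem_edgeSet_stage {A : ActivationProcess α} {i : ℕ} {e : Sym2 α} :
    e ∈ (A.stage i).edgeSet ↔
      e ∈ A.H.edgeSet ∨ ∃ j : Fin A.s, (j : ℕ) < i ∧ e ∈ (triangleGraph (A.Δ j)).edgeSet := by
  simp [stage, stageGraph]

theorem mem_edgeSet_finalGraph {A : ActivationProcess α} {e : Sym2 α} :
    e ∈ A.finalGraph.edgeSet ↔
      e ∈ A.H.edgeSet ∨ ∃ j : Fin A.s, e ∈ (triangleGraph (A.Δ j)).edgeSet := by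
  simp [finalGraph, mem_edgeSet_stage]

theorem mem_verts_stage {A : ActivationProcess α} {i : ℕ} {x : α} :
    x ∈ (A.stage i).verts ↔ x ∈ A.H.verts ∨ ∃ j : Fin A.s, (j : ℕ) < i ∧ x ∈ A.Δ j := by
  simp [stage, stageGraph, triangleGraph]

/-- Activation creates no new vertices, since two edges at every new vertex would be new. -/
theorem verts_stage_subset (A : ActivationProcess α) (i : ℕ) : (A.stage i).verts ⊆ A.H.verts := by
  classical
  induction i with
  | zero => intro x hx; simpa [mem_verts_stage] using hx
  | succ i ih =>
    intro x hx
    rcases mem_verts_stage.1 hx with hx | ⟨j, hj, hxj⟩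
    · exact hx
    · rcases Nat.lt_succ_iff_lt_or_eq.1 hj with hj | rfl
      · exact ih (mem_verts_stage.2 (Or.inr ⟨j, hj, hxj⟩))
      · obtain ⟨y, z, hyz, hyze⟩ := Finset.card_eq_two.1
          (show ((A.Δ j).erase x).card = 2 by rw [Finset.card_erase_of_mem hxj, A.card_eq_three])
        have hy : y ∈ (A.Δ j).erase x := by rw [hyze]; simp
        have hz : z ∈ (A.Δ j).erase x := by rw [hyze]; simp
        rw [Finset.mem_erase] at hy hz
        have ey := mem_edgeSet_triangleGraph.2 ⟨hxj, hy.2, hy.1.symm⟩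
        have ez := mem_edgeSet_triangleGraph.2 ⟨hxj, hz.2, hz.1.symm⟩
        apply ih
        by_contra hxs
        have hnew : ∀ w, s(x, w) ∉ (A.stage j).edgeSet := fun w hw =>
          hxs ((A.stage j).edge_vert hw)
        exact hyz (Sym2.congr_right.1
          ((A.existsUnique_new j).unique ⟨ey, hnew y⟩ ⟨ez, hnew z⟩))

theorem ActivatesAt.notMem_H {A : ActivationProcess α} {j : Fin A.s} {e : Sym2 α}
    (h : A.ActivatesAt j e) : e ∉ A.H.edgeSet :=
  fun he => h.2 (mem_edgeSet_stage.2 (Or.inl he))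

open Classical in
/-- The new edges of the final graph are activated exactly once. -/
theorem ncard_activatesAt {A : ActivationProcess α} {e : Sym2 α} (he : e ∈ A.finalGraph.edgeSet) :
    {j : Fin A.s | A.ActivatesAt j e}.ncard = if e ∈ A.H.edgeSet then 0 else 1 := by
  split_ifs with hH
  · rw [Set.ncard_eq_zero]
    exact Set.eq_empty_of_forall_notMem fun j hj => hj.notMem_H hH
  · have hex := (mem_edgeSet_finalGraph.1 he).resolve_left hH
    -- The first triangle containing `e` is the one that activates it.
    obtain ⟨k, hk, hmin⟩ := (Set.toFinite
      {j : Fin A.s | e ∈ (triangleGraph (A.Δ j)).edgeSet}).exists_minimal hex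
    have hfirst : A.ActivatesAt k e := by
      refine ⟨hk, fun hs => ?_⟩
      obtain ⟨j, hj, hje⟩ := (mem_edgeSet_stage.1 hs).resolve_left hH
      exact absurd (hmin hje (Fin.le_def.2 hj.le)) (not_le.2 hj)
    rw [Set.ncard_eq_one]
    refine ⟨k, Set.eq_singleton_iff_unique_mem.2 ⟨hfirst, fun j hj => ?_⟩⟩
    refine (lt_trichotomy j k).elim (fun h => ?_) fun h => h.elim id fun h => ?_
    · exact absurd (mem_edgeSet_stage.2 (Or.inr ⟨j, h, hj.1⟩)) hfirst.2
    · exact absurd (mem_edgeSet_stage.2 (Or.inr ⟨k, h, hfirst.1⟩)) hj.2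

open Classical in
/-- The label `e` occurs on the boundary `exc e + 2` or `exc e` times, according to whether it is an
edge of `H`. -/
theorem IsPartialDiagram.exists_presents_zero {n ℓ : ℕ} {A : ActivationProcess (Fin n)}
    {C : (⊤ : SimpleGraph (Fin n)).Subgraph} (hC : IsCycleGraphOfLength C ℓ) (hℓ : 3 ≤ ℓ)
    (hA : A.Activates C) {D : MarkedComplex (Fin n)} (h : A.IsPartialDiagram C 0 D) :
    ∃ p t, Presents D p t ∧ ∀ e,
      (((steps ((p :: t.inorder).map D.label)).count e : ℕ) : ℤ) =
        if e ∈ A.finalGraph.edgeSet then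
          A.edgeExc C e + 2 * (if e ∈ A.H.edgeSet then 1 else 0) else 0 := by
  obtain ⟨p, t, hP, hcount⟩ := h.exists_presents hC hℓ
  refine ⟨p, t, hP, fun e => ?_⟩
  have hc := hcount e
  have hcon : {j : Fin A.s | 0 ≤ (j : ℕ) ∧
      (e ∈ (triangleGraph (A.Δ j)).edgeSet ∧ ¬ A.ActivatesAt j e)}.ncard = A.con e := by
    simp [con]
  have hact : {j : Fin A.s | 0 ≤ (j : ℕ) ∧ A.ActivatesAt j e}.ncard =
      {j : Fin A.s | A.ActivatesAt j e}.ncard := by simp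
  rw [hcon, hact, BinaryTree.spineGaps_eq_steps, ← steps_map] at hc
  split_ifs with he hH
  · rw [ncard_activatesAt he, if_pos hH] at hc
    by_cases heC : e ∈ C.edgeSet
    · simp only [edgeExc, Set.mem_sdiff, hH, heC, not_true, and_false, if_false, if_true] at hc ⊢
      omega
    · simp only [edgeExc, Set.mem_sdiff, hH, heC, not_true, not_false_iff, and_self,
        if_false, if_true] at hc ⊢
      omega
  · rw [ncard_activatesAt he, if_neg hH] at hc
    by_cases heC : e ∈ C.edgeSet
    · simp only [edgeExc, Set.mem_sdiff, hH, heC, not_false_iff, and_true, if_true] at hc ⊢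
      omega
    · simp only [edgeExc, Set.mem_sdiff, hH, heC, false_and, if_false] at hc ⊢
      omega
  · have heC : e ∉ C.edgeSet := fun hh => he (SimpleGraph.Subgraph.edgeSet_mono hA hh)
    have h0 : A.con e = 0 := by
      rw [con, Set.ncard_eq_zero]
      exact Set.eq_empty_of_forall_notMem fun j hj =>
        he (mem_edgeSet_finalGraph.2 (Or.inr ⟨j, hj.1⟩))
    rw [h0, if_neg heC] at hc
    omega

end ActivationProcess

/-! ### The boundary word and the code of a diagram. -/

theorem exists_mem_steps {β : Type*} {h : List β} (hl : 2 ≤ h.length) {z : β} (hz : z ∈ h) :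
    ∃ e ∈ steps h, z ∈ e := by
  induction h with
  | nil => simp at hz
  | cons x t ih =>
    cases t with
    | nil => simp at hl
    | cons y t =>
      rcases List.mem_cons.1 hz with rfl | hz
      · exact ⟨s(z, y), by simp [steps], by simp⟩
      · cases t with
        | nil =>
          rw [List.mem_singleton] at hz
          subst hz
          exact ⟨s(x, z), by simp [steps], by simp⟩
        | cons w t =>
          obtain ⟨e, he, hze⟩ := ih (by simp) hz
          exact ⟨e, by rw [steps]; exact List.mem_cons_of_mem _ he, hze⟩

theorem length_steps {β : Type*} (x : β) (t : List β) : (steps (x :: t)).length = t.length := by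
  induction t generalizing x with
  | nil => rfl
  | cons y t ih => rw [steps, List.length_cons, ih, List.length_cons]

theorem ncard_verts_le {α : Type*} {H : (⊤ : SimpleGraph α).Subgraph} (hH : H.Connected) :
    H.verts.ncard ≤ H.edgeSet.ncard + 1 := by
  have h := hH.coe.card_vert_le_card_edgeSet_add_one
  rw [Nat.card_coe_set_eq, Nat.card_coe_set_eq] at h
  rwa [← SimpleGraph.Subgraph.image_coe_edgeSet_coe,
    Set.ncard_image_of_injective _ (Sym2.map.injective Subtype.val_injective)]

/-- The boundary word of an activation diagram is repetitive. -/
theorem boundary_mem_repetitiveWords {n v w : ℕ} (hv : 3 ≤ v) {A : ActivationProcess (Fin n)}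
    {C : (⊤ : SimpleGraph (Fin n)).Subgraph} (hH : A.H.Connected) (hnice : A.IsNice C)
    (hverts : A.H.verts.ncard = v)
    (hw : 2 * graphComplexity A.H + A.exc C = (w : ℤ)) {x : Fin n} {t : List (Fin n)}
    (hcount : ∀ e, (((steps (x :: t)).count e : ℕ) : ℤ) =
        open Classical in if e ∈ A.finalGraph.edgeSet then
          A.edgeExc C e + 2 * (if e ∈ A.H.edgeSet then 1 else 0) else 0) :
    x :: t ∈ repetitiveWords (Fin n) v w := by
  classical
  have hmem : ∀ e ∈ steps (x :: t), e ∈ A.finalGraph.edgeSet := by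
    intro e he
    by_contra hc
    have := hcount e
    rw [if_neg hc, Nat.cast_eq_zero, List.count_eq_zero] at this
    exact this he
  have hHfin : A.H.edgeSet ⊆ A.finalGraph.edgeSet := fun e he =>
    ActivationProcess.mem_edgeSet_finalGraph.2 (Or.inl he)
  have htwice : ∀ e ∈ A.H.edgeSet, 2 ≤ (steps (x :: t)).count e := by
    intro e he
    have h1 := hcount e
    rw [if_pos (hHfin he), if_pos he] at h1
    have h2 := hnice e (hHfin he)
    omega
  -- Summing `hcount` gives `exc A + 2|E(H)|`, and `2 d_H = 2|E(H)| - 2v + 2`.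
  have hlen : (t.length : ℤ) = 2 * v + w - 2 := by
    have h1 : ∑ e ∈ A.finalGraph.edgeSet.toFinset, (steps (x :: t)).count e = t.length := by
      rw [← length_steps x t, ← Multiset.coe_card, ← Multiset.sum_count_eq_card
        (s := A.finalGraph.edgeSet.toFinset) (fun e he => by simpa using hmem e he)]
      refine Finset.sum_congr rfl fun e _ => ?_
      rw [Multiset.coe_count]
    rw [← h1, Nat.cast_sum]
    have h2 : ∀ e ∈ A.finalGraph.edgeSet.toFinset, (((steps (x :: t)).count e : ℕ) : ℤ) =
        A.edgeExc C e + 2 * (if e ∈ A.H.edgeSet then 1 else 0) := fun e he => by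
      rw [hcount e, if_pos (by simpa using he)]
    rw [Finset.sum_congr rfl h2, Finset.sum_add_distrib, ← Finset.mul_sum, Finset.sum_boole]
    have h3 : A.finalGraph.edgeSet.toFinset.filter (· ∈ A.H.edgeSet) = A.H.edgeSet.toFinset := by
      ext e
      simp only [Finset.mem_filter, Set.mem_toFinset]
      exact ⟨fun h => h.2, fun h => ⟨hHfin h, h⟩⟩
    rw [h3, ← Set.ncard_eq_toFinset_card']
    have hexc : ∑ e ∈ A.finalGraph.edgeSet.toFinset, A.edgeExc C e = A.exc C := by
      rw [ActivationProcess.exc]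
    rw [graphComplexity, hverts] at hw
    rw [hexc]
    linarith
  have hedges := ncard_verts_le hH
  rw [hverts] at hedges
  rw [repetitiveWords, Finset.mem_filter, mem_wordsOfLength]
  refine ⟨by rw [List.length_cons]; omega, fun e he => ?_, ?_, ?_⟩
  · exact (⊤ : SimpleGraph (Fin n)).not_isDiag_of_mem_edgeSet
      (A.finalGraph.edgeSet_subset (hmem e he))
  · rw [← hverts, ← Set.ncard_coe_finset]
    congr 1
    ext z
    simp only [List.coe_toFinset, Set.mem_ofPred_eq]
    constructor
    · intro hz
      obtain ⟨e, he, hze⟩ := exists_mem_steps (by rw [List.length_cons]; omega) hz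
      obtain ⟨y, rfl⟩ := Sym2.mem_iff_exists.1 hze
      exact A.verts_stage_subset _ (A.finalGraph.edge_vert (hmem _ he))
    · intro hz
      -- A connected graph with more than one vertex has an edge at every vertex, and that edge
      -- occurs on the boundary.
      have : Nontrivial A.H.verts := by
        rw [Set.nontrivial_coe_sort, ← Set.one_lt_ncard_iff_nontrivial]
        omega
      obtain ⟨y, hy⟩ := hH.preconnected.exists_adj_of_nontrivial ⟨z, hz⟩
      have h2 := htwice s(z, y) hy
      exact mem_of_mem_steps (List.count_pos_iff.1 (by omega)) z (Sym2.mem_mk_left z y)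
  · refine hedges.trans (Nat.succ_le_succ ?_)
    rw [← Set.ncard_coe_finset]
    refine Set.ncard_le_ncard fun e he => ?_
    simpa [repeated] using htwice e he

/-- A code of an activation diagram: the shape of the tree and the boundary word. -/
theorem exists_code {ℓ n v w : ℕ} (hℓ : 3 ≤ ℓ) (hv : ℓ ≤ v)
    {q : Quotient (LabelledComplex.setoid (Fin n))} (hq : q ∈ nicePDiagrams ℓ n v w) :
    ∃ c ∈ BinaryTree.treesOfNumNodesEq (2 * v + w - 2) ×ˢ repetitiveWords (Fin n) v w,
      ∃ (D : MarkedComplex (Fin n)) (p : D.V) (t : BinaryTree D.V), Presents D p t ∧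
        q = Quotient.mk _ D.toLabelledComplex ∧ c.1 = t.map (fun _ => ()) ∧
        c.2 = (p :: t.inorder).map D.label := by
  obtain ⟨A, C, -, hC, hH, hA, hnice, hverts, hw, ⟨D, hD, rfl⟩, rfl⟩ := hq
  obtain ⟨p, t, hP, hcount⟩ := hD.exists_presents_zero hC hℓ hA
  have hword := boundary_mem_repetitiveWords (hℓ.trans hv) hH hnice hverts hw hcount
  refine ⟨(t.map (fun _ => ()), (p :: t.inorder).map D.label),
    Finset.mem_product.2 ⟨?_, hword⟩, D, p, t, hP, rfl, rfl, rfl⟩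
  rw [repetitiveWords, Finset.mem_filter, mem_wordsOfLength, List.length_cons,
    List.length_map] at hword
  rw [BinaryTree.mem_treesOfNumNodesEq, BinaryTree.numNodes_map,
    BinaryTree.numNodes_eq_length_inorder]
  omega

/-- The code of shape and boundary word is injective on isomorphism classes, by
`Presents.nonempty_iso`. -/
theorem encard_nicePDiagrams_le {ℓ n v w : ℕ} (hℓ : 3 ≤ ℓ) (hv : ℓ ≤ v) :
    (nicePDiagrams ℓ n v w).encard ≤
      ((catalan (2 * v + w - 2) * (repetitiveWords (Fin n) v w).card : ℕ) : ℕ∞) := by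
  classical
  choose! c hc hcode using fun q (hq : q ∈ nicePDiagrams ℓ n v w) => exists_code hℓ hv hq
  rw [← BinaryTree.treesOfNumNodesEq_card_eq_catalan, ← Finset.card_product,
    ← Set.encard_coe_eq_coe_finsetCard]
  refine Set.encard_le_encard_of_injOn (f := c) (fun q hq => hc q hq) fun q hq q' hq' h => ?_
  obtain ⟨D, p, t, hP, rfl, h1, h2⟩ := hcode q hq
  obtain ⟨D', p', t', hP', rfl, h1', h2'⟩ := hcode q' hq'
  refine Quotient.sound (hP.nonempty_iso hP' ?_ ?_)
  · rw [← h1, ← h1', h]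
  · rw [h, h2'] at h2
    exact (List.cons.inj h2).2.symm

/-! ### Numerical estimates and conclusion. -/

theorem catalan_le_four_pow (k : ℕ) : catalan k ≤ 4 ^ k := by
  rw [catalan_eq_centralBinom_div]
  exact (Nat.div_le_self _ _).trans (Nat.centralBinom_le_four_pow k)

theorem catalan_mul_card_repetitiveWords_le {n v w : ℕ} (hv : 2 ≤ v) :
    catalan (2 * v + w - 2) * (repetitiveWords (Fin n) v w).card ≤
      n ^ v * (2 * v) ^ (4 * w) * 2 ^ (7 * v) := by
  have h1 : (catalan (2 * v + w - 2) : ℝ) ≤ 4 ^ (2 * v + w - 2) := by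
    exact_mod_cast catalan_le_four_pow _
  have h2 := card_repetitiveWords_le (α := Fin n) (w := w) hv
  rw [Fintype.card_fin] at h2
  -- Each unit of `w` contributes `4 * 5/2 = 10 ≤ 2^4` and each unit of `v` contributes `10^2 ≤
  -- 2^7`; the `2^(4w)` turns `v^(4w)` into `(2v)^(4w)`.
  have h3 : (4 : ℝ) ^ (2 * v + w - 2) * (5 / 2) ^ (2 * v + w - 1) ≤
      2 ^ (4 * w) * 2 ^ (7 * v) := by
    obtain ⟨u, rfl⟩ : ∃ u, v = u + 2 := ⟨v - 2, by omega⟩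
    rw [show 2 * (u + 2) + w - 2 = 2 * u + w + 2 by omega,
      show 2 * (u + 2) + w - 1 = 2 * u + w + 3 by omega]
    calc (4 : ℝ) ^ (2 * u + w + 2) * (5 / 2) ^ (2 * u + w + 3)
        = 250 * 10 ^ w * 100 ^ u := by
          rw [show (10 : ℝ) = 4 * (5 / 2) by norm_num,
            show (100 : ℝ) = 4 ^ 2 * (5 / 2) ^ 2 by norm_num, mul_pow, mul_pow, ← pow_mul, ← pow_mul]
          ring
      _ ≤ 16384 * 16 ^ w * 128 ^ u := by gcongr <;> norm_num
      _ = _ := by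
          simp only [mul_add, pow_add, pow_mul]
          norm_num
          ring
  have h4 : ((catalan (2 * v + w - 2) * (repetitiveWords (Fin n) v w).card : ℕ) : ℝ) ≤
      ((n ^ v * (2 * v) ^ (4 * w) * 2 ^ (7 * v) : ℕ) : ℝ) := by
    push_cast
    calc _ ≤ (4 : ℝ) ^ (2 * v + w - 2) *
          ((n : ℝ) ^ v * (v : ℝ) ^ (4 * w) * (5 / 2) ^ (2 * v + w - 1)) := by gcongr
      _ = (n : ℝ) ^ v * (v : ℝ) ^ (4 * w) *
          ((4 : ℝ) ^ (2 * v + w - 2) * (5 / 2) ^ (2 * v + w - 1)) := by ring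
      _ ≤ (n : ℝ) ^ v * (v : ℝ) ^ (4 * w) * (2 ^ (4 * w) * 2 ^ (7 * v)) := by gcongr
      _ = _ := by rw [mul_pow]; ring
  exact_mod_cast h4

theorem mainTheorem7 (ℓ n v w : ℕ) (hℓ : 3 ≤ ℓ) (hv : ℓ ≤ v) :
    (nicePDiagrams ℓ n v w).encard ≤
      ((n ^ v * (2 * v) ^ (4 * w) * w ^ w * (2 * v + w - 2).choose w * 2 ^ (7 * v) : ℕ) : ℕ∞) := by
  refine (encard_nicePDiagrams_le hℓ hv).trans (Nat.cast_le.2 ?_)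
  refine (catalan_mul_card_repetitiveWords_le (by omega)).trans ?_
  have h1 : 1 ≤ w ^ w * (2 * v + w - 2).choose w := by
    refine Nat.mul_pos ?_ (Nat.choose_pos (by omega))
    rcases Nat.eq_zero_or_pos w with rfl | hw
    · simp
    · exact Nat.pow_pos hw
  calc n ^ v * (2 * v) ^ (4 * w) * 2 ^ (7 * v)
      ≤ n ^ v * (2 * v) ^ (4 * w) * 2 ^ (7 * v) * (w ^ w * (2 * v + w - 2).choose w) :=
        Nat.le_mul_of_pos_right _ h1
    _ = _ := by ring
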